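/- Let $G$ be an infinite group with identity $e$, generated as a semigroup by a finite symmetric set $S\subseteq G\setminus\{e\}$. Give each $s\in S$ a length $l(s)=l(s^{-1})>0$, and let $$d(x,y)=\min\Bigl\{\sum_{i=1}^n l(s_i)\ \Bigm|\ n\ge 0,\ s_1,\dots,s_n\in S,\ y=xs_1\cdots s_n\Bigr\}.$$ Let $\mathcal L=(\mathbb Z/2\mathbb Z)\wr G$ be the lamplighter group over $G$: its elements are the pairs $(\eta,x)$ with $\eta:G\to\mathbb Z/2\mathbb Z$ finitely supported and $x\in G$, and $(\eta_1,x)(\eta_2,y)=(\eta_1\oplus x\eta_2,\,xy)$, where $(x\eta)(w)=\eta(x^{-1}w)$. Let $\mu$ be a probability measure on $\mathcal L$ such that 1. $\operatorname{supp}(\mu)$ generates $\mathcal L$ as a semigroup (so the random walk below is irreducible); 2. there is $R\ge 0$ such that $\mu(\eta,x)>0$ implies $d(e,y)\le R$ for all $y\in\operatorname{supp}(\eta)$; 3. $\sum_{(\eta,x)\in\mathcal L} d(e,x)\,\mu(\eta,x)<\infty$. Let $\mathbf i_1,\mathbf i_2,\dots$ be i.i.d. random variables with law $\mu$, and let $Z_0=(\mathbf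 0,e)$ and $Z_n=Z_{n-1}\mathbf i_n=(\eta_n,X_n)$ for $n\ge 1$. Then the limit $$\ell_{\mathrm{supp}}=\lim_{n\to\infty}\frac{|\operatorname{supp}(\eta_n)|}{n}$$ exists almost surely and is almost surely equal to a real constant, and $\ell_{\mathrm{supp}}>0$ if and only if the projected walk $(X_n)_{n\ge 0}$ on $G$ is transient, i.e. $\mathbb P[\exists n\ge 1: X_n=e]<1$. -/

import Mathlib

open MeasureTheory ProbabilityTheory Filter Topology

/-- The lamplighter group `(ℤ/2ℤ) ≀ G` over `G`: pairs of a finitely supported lamp configuration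
`lamps : G → ℤ/2ℤ` and a position `pos : G` of the lamplighter. -/
@[ext]
structure Lamplighter (G : Type*) where
  lamps : G →₀ ZMod 2
  pos : G

namespace Lamplighter

variable {G : Type*} [Group G]

/-- The translated configuration `x η`, that is, `(x η)(w) = η (x⁻¹ w)`. -/
def translate (x : G) (η : G →₀ ZMod 2) : G →₀ ZMod 2 :=
  Finsupp.equivMapDomain (Equiv.mulLeft x) η

@[simp]
theorem translate_apply (x : G) (η : G →₀ ZMod 2) (w : G) :
    translate x η w = η (x⁻¹ * w) := rfl

/-- The product `(η₁, x) (η₂, y) = (η₁ ⊕ x η₂, x y)`. -/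
noncomputable instance : Mul (Lamplighter G) where
  mul a b := ⟨a.lamps + translate a.pos b.lamps, a.pos * b.pos⟩

noncomputable instance : One (Lamplighter G) where
  one := ⟨0, 1⟩

noncomputable instance : Inv (Lamplighter G) where
  inv a := ⟨-translate a.pos⁻¹ a.lamps, a.pos⁻¹⟩

@[simp]
theorem mul_lamps (a b : Lamplighter G) :
    (a * b).lamps = a.lamps + translate a.pos b.lamps := rfl

@[simp]
theorem mul_pos (a b : Lamplighter G) : (a * b).pos = a.pos * b.pos := rfl

@[simp]
theorem one_lamps : (1 : Lamplighter G).lamps = 0 := rfl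

@[simp]
theorem one_pos : (1 : Lamplighter G).pos = 1 := rfl

@[simp]
theorem inv_lamps (a : Lamplighter G) : (a⁻¹).lamps = -translate a.pos⁻¹ a.lamps := rfl

@[simp]
theorem inv_pos (a : Lamplighter G) : (a⁻¹).pos = a.pos⁻¹ := rfl

noncomputable instance : Group (Lamplighter G) :=
  Group.ofLeftAxioms
    (fun a b c => by
      ext w
      · simp [mul_assoc, add_assoc]
      · simp [mul_assoc])
    (fun a => by
      ext w
      · simp
      · simp)
    (fun a => by
      ext w
      · simp
      · simp)

/-- The lamplighter group carries the discrete σ-algebra. -/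
instance : MeasurableSpace (Lamplighter G) := ⊤

instance : DiscreteMeasurableSpace (Lamplighter G) where
  forall_measurableSet _ := trivial

/-- The random walk with increments `ξ 0, ξ 1, …`:  `Z_0 = (0, e)` and `Z_{n+1} = Z_n * ξ n`. -/
noncomputable def walk {Ω : Type*} (ξ : ℕ → Ω → Lamplighter G) : ℕ → Ω → Lamplighter G
  | 0, _ => 1
  | n + 1, ω => walk ξ n ω * ξ n ω

end Lamplighter

/-- The distance on the Cayley graph of `G` with respect to `S` in which an edge labelled `s ∈ S`
has length `l s`: the least total length of a word over `S` leading from `x` to `y`. -/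
noncomputable def cayleyDist {G : Type*} [Group G] (S : Finset G) (l : G → ℝ) (x y : G) : ℝ :=
  sInf {r : ℝ | ∃ w : List G, (∀ s ∈ w, s ∈ S) ∧ y = x * w.prod ∧ r = (w.map l).sum}

/-- A random walk `X` on a group, started at the identity, is transient if with positive
probability it never returns to the identity. -/
def TransientWalk {Ω G : Type*} [MeasurableSpace Ω] [Group G] (P : Measure Ω)
    (X : ℕ → Ω → G) : Prop :=
  P {ω | ∃ n : ℕ, 1 ≤ n ∧ X n ω = 1} < 1

/-!
The number of lit lamps `|supp η_n|` is subadditive along the increments: a product of two elements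
of the lamplighter group lights at most as many lamps as the two factors together. It grows by at
most `|K|` per step, where `K` is a finite ball containing the lamps an increment can switch. Hence
`|supp η_n| / n` converges almost surely to the limit `γ` of the mean rates `E|supp η_n| / n`, by
the subadditive ergodic theorem. For a bounded process driven by independent increments that theorem is
elementary: `limsup ≤ γ` is the strong law of large numbers over blocks
(`IsBddSubadditive.eventually_div_lt`), and `E[liminf] ≥ γ` follows by cutting `[0, n)` greedily
into intervals on which the average is close to the lower rate
(`IsBddSubadditive.lim_le_integral_lowerRate`).

The sign of `γ` is read off from expectations, by comparison with the range
`|{X_0, …, X_{n-1}}|` of the projected walk. Counting each site at its last visit, the expected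
range is the sum over `k < n` of the probabilities of no return to the identity up to time `k`, so divided
by `n` it tends to the escape probability.

* Lamps are lit only within `K` of visited sites, so `E|supp η_n|` is at most `|K|` times the
  expected range, and `γ = 0` for a recurrent projection (`Lamplighter.lampCount_pathWalk_le`).
* Let `a` switch the lamp at the identity and let `b` be a move to some `g ≠ 1`. By irreducibility
  `a` and `b` are products of possible increments; concatenating these in the two orders gives words
  of one common length `m` for `a * b` and `b * a`, which have the same position but differ at the
  lamp at the identity. Let the walk visit a site for the first time at time `t`. Whatever happens
  before `t` and after `t + m`, at least one of the two products in between leaves that site lit at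
  the end, so it is lit with conditional probability at least some `p > 0`. Summing over first
  visits, `E|supp η_{n+m}|` is at least `p` times the expected range at time `n`, and `γ > 0` if the
  projection is transient (`Lamplighter.exists_integral_lampCount_ge`).
-/

/-! ### The subadditive ergodic theorem for bounded processes -/

theorem integral_comp_eq_of_measurePreserving {Ω : Type*} [MeasurableSpace Ω] {T : Ω → Ω}
    {P : Measure Ω} (hT : MeasurePreserving T P P) {g : Ω → ℝ} (hg : Measurable g) :
    ∫ ω, g (T ω) ∂P = ∫ ω, g ω ∂P := by
  conv_rhs => rw [← hT.map_eq]
  rw [integral_map hT.measurable.aemeasurable hg.aestronglyMeasurable]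

/-- A nonnegative subadditive process over the transformation `T`: `a (m + n) ≤ a m + a n ∘ T^m`,
bounded by `C` per unit of time. -/
structure IsBddSubadditive {Ω : Type*} [MeasurableSpace Ω] (T : Ω → Ω) (a : ℕ → Ω → ℝ) (C : ℝ) :
    Prop where
  measurable : ∀ n, Measurable (a n)
  nonneg : ∀ n ω, 0 ≤ a n ω
  le_mul : ∀ n ω, a n ω ≤ n * C
  subadd : ∀ m n ω, a (m + n) ω ≤ a m ω + a n (T^[m] ω)

/-- The stopping argument behind the lower bound in the subadditive ergodic theorem. The array
`b i n` stands for the value of the process on the time interval `[i, i + n)`. If from each time `i`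
that is not bad some interval of length at most `M` has average at most `d`, then `[i, i + n)` is
cut greedily into such intervals, single bad times, and a remainder of length at most `M`. -/
theorem subadditive_array_le {b : ℕ → ℕ → ℝ} {C d : ℝ} {M : ℕ} (hd : 0 ≤ d)
    (hsub : ∀ i m n, b i (m + n) ≤ b i m + b (i + m) n) (hC : ∀ i n, b i n ≤ n * C) (hC0 : 0 ≤ C)
    (bad : ℕ → Prop) [DecidablePred bad]
    (hgood : ∀ i, ¬ bad i → ∃ k, 1 ≤ k ∧ k ≤ M ∧ b i k ≤ k * d) (n i : ℕ) :
    b i n ≤ n * d + C * (∑ j ∈ Finset.range n, if bad (i + j) then (1 : ℝ) else 0) + M * C := by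
  induction n using Nat.strong_induction_on generalizing i with
  | _ n ih =>
    have hsum0 : ∀ (n i : ℕ), (0 : ℝ) ≤ ∑ j ∈ Finset.range n, if bad (i + j) then (1 : ℝ) else 0 :=
      fun n i => Finset.sum_nonneg fun j _ => by split_ifs <;> norm_num
    have hsplit : ∀ k r : ℕ, (∑ j ∈ Finset.range (k + r), if bad (i + j) then (1 : ℝ) else 0)
        = (∑ j ∈ Finset.range k, if bad (i + j) then (1 : ℝ) else 0)
          + ∑ j ∈ Finset.range r, if bad (i + k + j) then (1 : ℝ) else 0 := by
      intro k r
      rw [Finset.sum_range_add]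
      simp [add_assoc]
    by_cases hnM : n ≤ M
    · have h1 : (n : ℝ) * C ≤ M * C := by gcongr
      have h2 := hC i n
      have h3 := hsum0 n i
      have : 0 ≤ (n : ℝ) * d := by positivity
      have : 0 ≤ C * ∑ j ∈ Finset.range n, if bad (i + j) then (1 : ℝ) else 0 := by positivity
      linarith
    push Not at hnM
    by_cases hb : bad i
    · obtain ⟨r, rfl⟩ : ∃ r, n = 1 + r := ⟨n - 1, by omega⟩
      have h1 := ih r (by omega) (i + 1)
      have h2 := hsub i 1 r
      have h3 := hC i 1
      rw [hsplit]
      simp only [Finset.range_one, Finset.sum_singleton, add_zero, hb, if_true]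
      push_cast at h3 ⊢
      linarith
    · obtain ⟨k, hk1, hkM, hk⟩ := hgood i hb
      obtain ⟨r, rfl⟩ : ∃ r, n = k + r := ⟨n - k, by omega⟩
      have h1 := ih r (by omega) (i + k)
      have h2 := hsub i k r
      have h3 := mul_nonneg hC0 (hsum0 k i)
      rw [hsplit]
      push_cast
      linarith

namespace IsBddSubadditive

variable {Ω : Type*} [MeasurableSpace Ω] {T : Ω → Ω} {a : ℕ → Ω → ℝ} {C : ℝ}
  {P : Measure Ω}

theorem bound_nonneg [Nonempty Ω] (h : IsBddSubadditive T a C) : 0 ≤ C := by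
  have ω : Ω := Classical.arbitrary Ω
  simpa using (h.nonneg 1 ω).trans (h.le_mul 1 ω)

theorem integrable [IsProbabilityMeasure P] (h : IsBddSubadditive T a C) (n : ℕ) :
    Integrable (a n) P :=
  Integrable.of_bound (h.measurable n).aestronglyMeasurable (n * C) <| ae_of_all _ fun ω => by
    rw [Real.norm_eq_abs, abs_of_nonneg (h.nonneg n ω)]
    exact h.le_mul n ω

theorem subadditive_integral [IsProbabilityMeasure P] (hT : MeasurePreserving T P P)
    (h : IsBddSubadditive T a C) : Subadditive fun n => ∫ ω, a n ω ∂P := by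
  intro m n
  have hi : Integrable (fun ω => a n (T^[m] ω)) P :=
    (hT.iterate m).integrable_comp_of_integrable (h.integrable n)
  have he := integral_comp_eq_of_measurePreserving (hT.iterate m) (h.measurable n)
  calc ∫ ω, a (m + n) ω ∂P ≤ ∫ ω, (a m ω + a n (T^[m] ω)) ∂P :=
        integral_mono (h.integrable _) ((h.integrable m).add hi) (h.subadd m n)
    _ = _ := by rw [integral_add (h.integrable m) hi, he]

theorem bddBelow_integral (h : IsBddSubadditive T a C) :
    BddBelow (Set.range fun n : ℕ => (∫ ω, a n ω ∂P) / n) := by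
  refine ⟨0, ?_⟩
  rintro _ ⟨n, rfl⟩
  exact div_nonneg (integral_nonneg (h.nonneg n)) (Nat.cast_nonneg n)

theorem div_nonneg (h : IsBddSubadditive T a C) (n : ℕ) (ω : Ω) : 0 ≤ a n ω / n :=
  _root_.div_nonneg (h.nonneg n ω) (Nat.cast_nonneg n)

theorem div_le [Nonempty Ω] (h : IsBddSubadditive T a C) (n : ℕ) (ω : Ω) : a n ω / n ≤ C :=
  div_le_of_le_mul₀ (Nat.cast_nonneg n) h.bound_nonneg (by simpa [mul_comm] using h.le_mul n ω)

theorem isBoundedUnder_ge (h : IsBddSubadditive T a C) (ω : Ω) :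
    IsBoundedUnder (· ≥ ·) atTop fun n : ℕ => a n ω / n :=
  isBoundedUnder_of ⟨0, fun n => h.div_nonneg n ω⟩

theorem isBoundedUnder_le [Nonempty Ω] (h : IsBddSubadditive T a C) (ω : Ω) :
    IsBoundedUnder (· ≤ ·) atTop fun n : ℕ => a n ω / n :=
  isBoundedUnder_of ⟨C, fun n => h.div_le n ω⟩

/-- The lower growth rate of a subadditive process. -/
noncomputable def lowerRate (a : ℕ → Ω → ℝ) (ω : Ω) : ℝ :=
  liminf (fun n : ℕ => a n ω / n) atTop

theorem measurable_lowerRate (h : IsBddSubadditive T a C) : Measurable (lowerRate a) :=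
  Measurable.liminf fun n => (h.measurable n).div_const _

theorem lowerRate_nonneg [Nonempty Ω] (h : IsBddSubadditive T a C) (ω : Ω) :
    0 ≤ lowerRate a ω :=
  le_liminf_of_le (h.isBoundedUnder_le ω).isCoboundedUnder_ge
    (Eventually.of_forall fun n => h.div_nonneg n ω)

theorem lowerRate_le [Nonempty Ω] (h : IsBddSubadditive T a C) (ω : Ω) : lowerRate a ω ≤ C :=
  liminf_le_of_frequently_le (Frequently.of_forall fun n => h.div_le n ω)
    (h.isBoundedUnder_ge ω)

theorem integrable_lowerRate [IsProbabilityMeasure P] (h : IsBddSubadditive T a C) :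
    Integrable (lowerRate a) P := by
  have : Nonempty Ω := nonempty_of_isProbabilityMeasure P
  refine Integrable.of_bound h.measurable_lowerRate.aestronglyMeasurable C <|
    ae_of_all _ fun ω => ?_
  rw [Real.norm_eq_abs, abs_of_nonneg (h.lowerRate_nonneg ω)]
  exact h.lowerRate_le ω

theorem lowerRate_le_comp [Nonempty Ω] (h : IsBddSubadditive T a C) (ω : Ω) :
    lowerRate a ω ≤ lowerRate a (T ω) := by
  refine le_of_forall_gt_imp_ge_of_dense fun r hr => ?_
  obtain ⟨s, hs, hsr⟩ := exists_between hr
  have hfreq : ∃ᶠ n : ℕ in atTop, a n (T ω) / n < s :=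
    frequently_lt_of_liminf_lt (h.isBoundedUnder_le _).isCoboundedUnder_ge hs
  have hs0 : 0 ≤ s := (h.lowerRate_nonneg _).trans hs.le
  have hev : ∀ᶠ n : ℕ in atTop, C / (n + 1 : ℕ) < r - s := by
    have : Tendsto (fun n : ℕ => C / ((n + 1 : ℕ) : ℝ)) atTop (𝓝 0) :=
      (tendsto_const_div_atTop_nhds_zero_nat C).comp (tendsto_add_atTop_nat 1)
    exact this.eventually (gt_mem_nhds (by linarith))
  have hfreq' : ∃ᶠ n : ℕ in atTop, a (n + 1) ω / (n + 1 : ℕ) ≤ r := by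
    refine (hfreq.and_eventually (hev.and (eventually_gt_atTop 0))).mono ?_
    rintro n ⟨h1, h2, hn⟩
    have hn' : (0 : ℝ) < n := by exact_mod_cast hn
    rw [div_lt_iff₀ hn'] at h1
    rw [div_lt_iff₀ (by positivity)] at h2
    rw [div_le_iff₀ (by positivity)]
    have h3 := h.subadd 1 n ω
    rw [add_comm 1 n, Function.iterate_one] at h3
    have h4 := h.le_mul 1 ω
    push_cast at *
    linarith
  refine liminf_le_of_frequently_le ?_ (h.isBoundedUnder_ge ω)
  exact (tendsto_add_atTop_nat 1).frequently hfreq'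

theorem lowerRate_comp_ae_eq [IsProbabilityMeasure P] (hT : MeasurePreserving T P P)
    (h : IsBddSubadditive T a C) : ∀ᵐ ω ∂P, ∀ i, lowerRate a (T^[i] ω) = lowerRate a ω := by
  have : Nonempty Ω := nonempty_of_isProbabilityMeasure P
  have hint := h.integrable_lowerRate (P := P)
  have hint' : Integrable (fun ω => lowerRate a (T ω)) P :=
    hT.integrable_comp_of_integrable hint
  have hz : ∫ ω, (lowerRate a (T ω) - lowerRate a ω) ∂P = 0 := by
    rw [integral_sub hint' hint]
    rw [integral_comp_eq_of_measurePreserving hT h.measurable_lowerRate, sub_self]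
  have hae := (integral_eq_zero_iff_of_nonneg
    (fun ω => sub_nonneg.2 (h.lowerRate_le_comp ω)) (hint'.sub hint)).1 hz
  have hall : ∀ᵐ ω ∂P, ∀ i, lowerRate a (T (T^[i] ω)) - lowerRate a (T^[i] ω) = 0 :=
    ae_all_iff.2 fun i => (hT.iterate i).quasiMeasurePreserving.ae hae
  filter_upwards [hall] with ω hω i
  induction i with
  | zero => rfl
  | succ i ih =>
    rw [Function.iterate_succ_apply']
    linarith [hω i]

/-- The integral of the lower growth rate dominates the limit of the mean growth rates. -/
theorem lim_le_integral_lowerRate [IsProbabilityMeasure P] (hT : MeasurePreserving T P P)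
    (h : IsBddSubadditive T a C) :
    (h.subadditive_integral hT).lim ≤ ∫ ω, lowerRate a ω ∂P := by
  have : Nonempty Ω := nonempty_of_isProbabilityMeasure P
  have hC := h.bound_nonneg
  set f := lowerRate a
  refine le_of_forall_pos_le_add fun ε hε => ?_
  -- `bad M` is the event that no average over the first `M` times is close to the lower rate.
  let bad : ℕ → Set Ω := fun M => {ω | ∀ k, 1 ≤ k → k ≤ M → k * (f ω + ε) < a k ω}
  have hbad_meas : ∀ M, MeasurableSet (bad M) := by
    intro M
    have : bad M = ⋂ k : ℕ, ⋂ (_ : 1 ≤ k), ⋂ (_ : k ≤ M), {ω | k * (f ω + ε) < a k ω} := by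
      ext ω; simp [bad]
    rw [this]
    refine MeasurableSet.iInter fun k => MeasurableSet.iInter fun _ => MeasurableSet.iInter fun _ =>
      measurableSet_lt ?_ (h.measurable k)
    exact (h.measurable_lowerRate.add_const ε).const_mul _
  have hbad_anti : Antitone bad := fun M N hMN ω hω k hk1 hk => hω k hk1 (hk.trans hMN)
  have hbad_empty : ⋂ M, bad M = ∅ := by
    refine Set.eq_empty_of_forall_notMem fun ω hω => ?_
    have hlt : f ω < f ω + ε := by linarith
    have hfr : ∃ᶠ n : ℕ in atTop, a n ω / n < f ω + ε :=
      frequently_lt_of_liminf_lt (h.isBoundedUnder_le _).isCoboundedUnder_ge hlt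
    obtain ⟨n, hn, hn1⟩ := (hfr.and_eventually (eventually_ge_atTop 1)).exists
    have hn' : (0 : ℝ) < n := by exact_mod_cast hn1
    rw [div_lt_iff₀ hn'] at hn
    have := Set.mem_iInter.1 hω n n hn1 le_rfl
    linarith
  have hlim : Tendsto (fun M => P.real (bad M)) atTop (𝓝 0) := by
    have := tendsto_measure_iInter_atTop (μ := P) (fun M => (hbad_meas M).nullMeasurableSet)
      hbad_anti ⟨0, measure_ne_top _ _⟩
    rw [hbad_empty, measure_empty] at this
    exact (ENNReal.tendsto_toReal ENNReal.zero_ne_top).comp this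
  have key : ∀ M n : ℕ, ∫ ω, a n ω ∂P ≤
      n * (∫ ω, f ω ∂P + ε) + C * (n * P.real (bad M)) + M * C := by
    classical
    intro M n
    have hpt : ∀ᵐ ω ∂P, a n ω ≤ n * (f ω + ε) +
        C * (∑ j ∈ Finset.range n, (bad M).indicator (fun _ => (1 : ℝ)) (T^[j] ω)) + M * C := by
      filter_upwards [h.lowerRate_comp_ae_eq hT] with ω hω
      have := subadditive_array_le (b := fun i n => a n (T^[i] ω)) (C := C) (d := f ω + ε) (M := M)
        (by linarith [h.lowerRate_nonneg ω])
        (fun i m n => by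
          have := h.subadd m n (T^[i] ω)
          rwa [← Function.iterate_add_apply, add_comm m i] at this)
        (fun i n => h.le_mul n _) hC (fun j => T^[j] ω ∈ bad M)
        (fun i hi => by
          simp only [bad, Set.mem_ofPred_eq] at hi
          push Not at hi
          obtain ⟨k, h1, h2, h3⟩ := hi
          rw [show f (T^[i] ω) = f ω from hω i] at h3
          exact ⟨k, h1, h2, h3⟩) n 0
      simpa [Set.indicator_apply] using this
    have hind : Integrable ((bad M).indicator fun _ => (1 : ℝ)) P :=
      (integrable_const _).indicator (hbad_meas M)
    have hindT : ∀ j, Integrable (fun ω => (bad M).indicator (fun _ => (1 : ℝ)) (T^[j] ω)) P :=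
      fun j => (hT.iterate j).integrable_comp_of_integrable hind
    have hindI : ∀ j, ∫ ω, (bad M).indicator (fun _ => (1 : ℝ)) (T^[j] ω) ∂P = P.real (bad M) := by
      intro j
      have h1 : ∫ ω, (bad M).indicator (fun _ => (1 : ℝ)) ω ∂P = P.real (bad M) := by
        rw [integral_indicator (hbad_meas M)]; simp
      rw [← h1]
      exact integral_comp_eq_of_measurePreserving (hT.iterate j)
        (measurable_const.indicator (hbad_meas M))
    have hi1 : Integrable (fun ω => n * (f ω + ε)) P :=
      (h.integrable_lowerRate.add (integrable_const ε)).const_mul _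
    have hi2 : Integrable (fun ω =>
        C * (∑ j ∈ Finset.range n, (bad M).indicator (fun _ => (1 : ℝ)) (T^[j] ω))) P :=
      (integrable_finsetSum _ fun j _ => hindT j).const_mul _
    refine (integral_mono_ae (h.integrable n) ((hi1.add hi2).add (integrable_const _)) hpt).trans
      (le_of_eq ?_)
    rw [integral_add' (hi1.add hi2) (integrable_const _), integral_add' hi1 hi2,
      integral_const_mul, integral_const_mul, integral_finsetSum _ fun j _ => hindT j,
      integral_add h.integrable_lowerRate (integrable_const ε)]
    simp [hindI, f]
  have key2 : ∀ M : ℕ, (h.subadditive_integral hT).lim ≤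
      ∫ ω, f ω ∂P + ε + C * P.real (bad M) := by
    intro M
    have ht : Tendsto
        (fun n : ℕ => (∫ ω, f ω ∂P + ε) + C * P.real (bad M) + (M * C) / (n : ℝ)) atTop
        (𝓝 ((∫ ω, f ω ∂P + ε) + C * P.real (bad M) + 0)) :=
      tendsto_const_nhds.add (tendsto_const_div_atTop_nhds_zero_nat _)
    rw [add_zero] at ht
    refine ge_of_tendsto ht ?_
    filter_upwards [eventually_gt_atTop 0] with n hn
    refine ((h.subadditive_integral hT).lim_le_div h.bddBelow_integral hn.ne').trans ?_
    have hn' : (0 : ℝ) < n := by exact_mod_cast hn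
    rw [div_le_iff₀ hn']
    refine (key M n).trans (le_of_eq ?_)
    field_simp
  have ht2 : Tendsto (fun M => ∫ ω, f ω ∂P + ε + C * P.real (bad M)) atTop
      (𝓝 (∫ ω, f ω ∂P + ε + C * 0)) := tendsto_const_nhds.add (hlim.const_mul C)
  rw [mul_zero, add_zero] at ht2
  exact ge_of_tendsto' ht2 key2

/-- If the process satisfies the law of large numbers along blocks of each fixed length, then it is
asymptotically bounded by the limit of its mean growth rates. -/
theorem eventually_div_lt [IsProbabilityMeasure P] (hT : MeasurePreserving T P P)
    (h : IsBddSubadditive T a C)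
    (hlln : ∀ m, 1 ≤ m → ∀ᵐ ω ∂P, Tendsto
      (fun k : ℕ => (∑ i ∈ Finset.range k, a m (T^[m * i] ω)) / k) atTop (𝓝 (∫ ω, a m ω ∂P))) :
    ∀ᵐ ω ∂P, ∀ r, (h.subadditive_integral hT).lim < r → ∀ᶠ n : ℕ in atTop, a n ω / n < r := by
  have : Nonempty Ω := nonempty_of_isProbabilityMeasure P
  have hC := h.bound_nonneg
  have hall : ∀ᵐ ω ∂P, ∀ m, 1 ≤ m → Tendsto
      (fun k : ℕ => (∑ i ∈ Finset.range k, a m (T^[m * i] ω)) / k) atTop (𝓝 (∫ ω, a m ω ∂P)) := by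
    rw [ae_all_iff]
    intro m
    by_cases hm : 1 ≤ m
    · filter_upwards [hlln m hm] with ω hω _ using hω
    · exact ae_of_all _ fun ω h' => absurd h' hm
  filter_upwards [hall] with ω hω r hr
  obtain ⟨m, hm1, hm⟩ : ∃ m : ℕ, 1 ≤ m ∧ (∫ ω, a m ω ∂P) / m < r := by
    have := ((h.subadditive_integral hT).tendsto_lim h.bddBelow_integral).eventually
      (gt_mem_nhds hr)
    obtain ⟨m, h1, h2⟩ := (this.and (eventually_ge_atTop 1)).exists
    exact ⟨m, h2, h1⟩
  have hm0 : (0 : ℝ) < m := by exact_mod_cast hm1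
  have hblocks : ∀ k q : ℕ, a (m * k + q) ω ≤
      ∑ i ∈ Finset.range k, a m (T^[m * i] ω) + a q (T^[m * k] ω) := by
    intro k
    induction k with
    | zero => intro q; simp
    | succ k ih =>
      intro q
      have h1 := ih (m + q)
      have h2 := h.subadd m q (T^[m * k] ω)
      rw [← Function.iterate_add_apply] at h2
      rw [Finset.sum_range_succ]
      have e1 : m * (k + 1) + q = m * k + (m + q) := by ring
      have e2 : m * (k + 1) = m + m * k := by ring
      rw [e1, e2]
      linarith
  have hbd : ∀ n : ℕ, 0 < n → a n ω / n ≤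
      ((∑ i ∈ Finset.range (n / m), a m (T^[m * i] ω)) / (n / m : ℕ)) / m + (m * C) / n := by
    intro n hn
    have hn' : (0 : ℝ) < n := by exact_mod_cast hn
    have h1 := hblocks (n / m) (n % m)
    rw [Nat.div_add_mod] at h1
    have h2 : a (n % m) (T^[m * (n / m)] ω) ≤ m * C := by
      refine (h.le_mul _ _).trans ?_
      gcongr
      exact (Nat.mod_lt _ hm1).le
    have hs : 0 ≤ ∑ i ∈ Finset.range (n / m), a m (T^[m * i] ω) :=
      Finset.sum_nonneg fun i _ => h.nonneg _ _
    have h3 : (∑ i ∈ Finset.range (n / m), a m (T^[m * i] ω)) / n ≤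
        ((∑ i ∈ Finset.range (n / m), a m (T^[m * i] ω)) / (n / m : ℕ)) / m := by
      rcases Nat.eq_zero_or_pos (n / m) with hq | hq
      · simp [hq]
      · rw [div_div]
        have hq' : (0 : ℝ) < (n / m : ℕ) := by exact_mod_cast hq
        refine div_le_div_of_nonneg_left hs (by positivity) ?_
        exact_mod_cast Nat.div_mul_le_self n m
    calc a n ω / n ≤ (∑ i ∈ Finset.range (n / m), a m (T^[m * i] ω) + m * C) / n := by
          gcongr; linarith
      _ = (∑ i ∈ Finset.range (n / m), a m (T^[m * i] ω)) / n + (m * C) / n := add_div _ _ _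
      _ ≤ _ := by gcongr
  have ht : Tendsto (fun n : ℕ =>
      ((∑ i ∈ Finset.range (n / m), a m (T^[m * i] ω)) / (n / m : ℕ)) / m + (m * C) / n) atTop
      (𝓝 ((∫ ω, a m ω ∂P) / m + 0)) :=
    (((hω m hm1).comp (Nat.tendsto_div_const_atTop (by omega))).div_const _).add
      (tendsto_const_div_atTop_nhds_zero_nat _)
  rw [add_zero] at ht
  filter_upwards [ht.eventually (gt_mem_nhds hm), eventually_gt_atTop 0] with n h1 h2
  exact (hbd n h2).trans_lt h1

/-- The subadditive ergodic theorem for a bounded process satisfying the law of large numbers along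
blocks of each fixed length: the normalized process converges to the limit of the mean growth
rates. -/
theorem ae_tendsto_lim [IsProbabilityMeasure P] (hT : MeasurePreserving T P P)
    (h : IsBddSubadditive T a C)
    (hlln : ∀ m, 1 ≤ m → ∀ᵐ ω ∂P, Tendsto
      (fun k : ℕ => (∑ i ∈ Finset.range k, a m (T^[m * i] ω)) / k) atTop (𝓝 (∫ ω, a m ω ∂P))) :
    ∀ᵐ ω ∂P, Tendsto (fun n : ℕ => a n ω / n) atTop (𝓝 (h.subadditive_integral hT).lim) := by
  have : Nonempty Ω := nonempty_of_isProbabilityMeasure P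
  have hup := h.eventually_div_lt hT hlln
  set γ := (h.subadditive_integral hT).lim
  have hle : ∀ᵐ ω ∂P, 0 ≤ γ - lowerRate a ω := by
    filter_upwards [hup] with ω hω
    rw [sub_nonneg]
    refine le_of_forall_gt_imp_ge_of_dense fun r hr => ?_
    exact liminf_le_of_frequently_le ((hω r hr).mono fun n hn => hn.le).frequently
      (h.isBoundedUnder_ge ω)
  -- The lower rate is at most `γ` and has integral at least `γ`, so it equals `γ`.
  have hint : Integrable (fun ω => γ - lowerRate a ω) P :=
    (integrable_const _).sub h.integrable_lowerRate
  have hz : ∫ ω, (γ - lowerRate a ω) ∂P = 0 := by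
    refine le_antisymm ?_ (integral_nonneg_of_ae hle)
    rw [integral_sub (integrable_const _) h.integrable_lowerRate]
    simpa using h.lim_le_integral_lowerRate hT
  have heq := (integral_eq_zero_iff_of_nonneg_ae hle hint).1 hz
  filter_upwards [hup, heq] with ω h1 h2
  simp only [Pi.zero_apply] at h2
  refine tendsto_order.2 ⟨fun r hr => ?_, h1⟩
  refine eventually_lt_of_lt_liminf (f := atTop) (u := fun n : ℕ => a n ω / n) ?_
    (h.isBoundedUnder_ge ω)
  change r < lowerRate a ω
  linarith

end IsBddSubadditive

/-! ### Sequences of independent increments -/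

/-- The left shift on sequences. -/
def shift {E : Type*} (w : ℕ → E) : ℕ → E := fun i => w (i + 1)

theorem shift_iterate_apply {E : Type*} (k i : ℕ) (w : ℕ → E) : shift^[k] w i = w (i + k) := by
  induction k generalizing w with
  | zero => rfl
  | succ k ih => rw [Function.iterate_succ_apply, ih, shift, add_assoc]

theorem DependsOn.comp_shift_iterate {E β : Type*} {f : (ℕ → E) → β} {n : ℕ}
    (hf : DependsOn f (Finset.range n)) (k : ℕ) :
    DependsOn (fun w => f (shift^[k] w)) (Finset.Ico k (k + n)) := by
  intro x y hxy
  refine hf fun i hi => ?_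
  rw [shift_iterate_apply, shift_iterate_apply]
  simp only [Finset.coe_range, Set.mem_Iio] at hi
  exact hxy _ (by simp; omega)

theorem DependsOn.exists_eq_comp_restrict {ι E β : Type*} [Nonempty E] {f : (ι → E) → β}
    {s : Finset ι} (hf : DependsOn f s) :
    ∃ g : (s → E) → β, ∀ w, f w = g fun i => w i := by
  classical
  refine ⟨fun v => f fun i => if h : i ∈ s then v ⟨i, h⟩ else Classical.arbitrary E, fun w => ?_⟩
  refine hf fun i hi => ?_
  have : i ∈ s := by simpa using hi
  simp [this]

/-- The law of a sequence of independent random variables with common law `ν`. -/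
noncomputable abbrev iidMeasure {E : Type*} [MeasurableSpace E] (ν : Measure E)
    [IsProbabilityMeasure ν] : Measure (ℕ → E) := Measure.infinitePi fun _ => ν

theorem measurePreserving_shift {E : Type*} [MeasurableSpace E] (ν : Measure E)
    [IsProbabilityMeasure ν] : MeasurePreserving shift (iidMeasure ν) (iidMeasure ν) where
  measurable := measurable_pi_lambda _ fun i => measurable_pi_apply (i + 1)
  map_eq := Measure.map_infinitePi_infinitePi_of_inj (P := fun _ => ν) (add_left_injective 1)

section DiscreteIncrements

variable {E : Type*} [MeasurableSpace E] [DiscreteMeasurableSpace E] [Countable E]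

/-- A function of finitely many coordinates in a countable discrete space is measurable. -/
theorem DependsOn.measurable_of_finset {ι β : Type*} [MeasurableSpace β] [Nonempty E]
    {f : (ι → E) → β} {s : Finset ι} (hf : DependsOn f s) : Measurable f := by
  obtain ⟨g, hg⟩ := hf.exists_eq_comp_restrict
  rw [show f = g ∘ fun w i => w i from funext hg]
  exact (Measurable.of_discrete (f := g)).comp (by fun_prop)

theorem DependsOn.measurableSet_of_finset {ι : Type*} [Nonempty E]
    {p : (ι → E) → Prop} {s : Finset ι} (hp : DependsOn p s) : MeasurableSet {w | p w} :=
  measurableSet_setOfPred.2 hp.measurable_of_finset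

variable (ν : Measure E) [IsProbabilityMeasure ν]

theorem indepFun_of_dependsOn {β γ : Type*} [MeasurableSpace β] [MeasurableSpace γ]
    {f : (ℕ → E) → β} {g : (ℕ → E) → γ} {s t : Finset ℕ} (hf : DependsOn f s)
    (hg : DependsOn g t) (hst : Disjoint s t) : IndepFun f g (iidMeasure ν) := by
  have : Nonempty E := nonempty_of_isProbabilityMeasure ν
  obtain ⟨f', hf'⟩ := hf.exists_eq_comp_restrict
  obtain ⟨g', hg'⟩ := hg.exists_eq_comp_restrict
  have hind : iIndepFun (fun (i : ℕ) (w : ℕ → E) => w i) (iidMeasure ν) :=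
    iIndepFun_infinitePi (P := fun _ => ν) (X := fun _ x => x) fun _ => measurable_id
  have := (hind.indepFun_finset s t hst fun i => measurable_pi_apply i).comp
    (Measurable.of_discrete (f := f')) (Measurable.of_discrete (f := g'))
  rwa [show f = f' ∘ fun w i => w i from funext hf', show g = g' ∘ fun w i => w i from funext hg']

theorem iidMeasure_real_and {p q : (ℕ → E) → Prop} {s t : Finset ℕ} (hp : DependsOn p s)
    (hq : DependsOn q t) (hst : Disjoint s t) :
    (iidMeasure ν).real {w | p w ∧ q w} =
      (iidMeasure ν).real {w | p w} * (iidMeasure ν).real {w | q w} := by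
  have := (indepFun_of_dependsOn ν hp hq hst).measure_inter_preimage_eq_mul {True} {True}
    (MeasurableSet.of_discrete) (MeasurableSet.of_discrete)
  have e : ∀ r : (ℕ → E) → Prop, r ⁻¹' {True} = {w | r w} := fun r => by ext w; simp
  rw [e, e] at this
  simpa [Measure.real, Set.ofPred_and] using congrArg ENNReal.toReal this

/-- The subadditive ergodic theorem for independent increments. -/
theorem IsBddSubadditive.ae_tendsto_lim_of_dependsOn {a : ℕ → (ℕ → E) → ℝ} {C : ℝ}
    (h : IsBddSubadditive shift a C) (hdep : ∀ n, DependsOn (a n) (Finset.range n)) :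
    ∀ᵐ w ∂iidMeasure ν, Tendsto (fun n : ℕ => a n w / n) atTop
      (𝓝 (h.subadditive_integral (measurePreserving_shift ν)).lim) := by
  refine h.ae_tendsto_lim (measurePreserving_shift ν) fun m hm => ?_
  have hT := fun i => (measurePreserving_shift ν).iterate (m * i)
  refine strong_law_ae_real (μ := iidMeasure ν) (fun i w => a m (shift^[m * i] w))
    (h.integrable m) ?_ fun i => ?_
  · have aux : ∀ i j, i < j → Disjoint (Finset.Ico (m * i) (m * i + m))
        (Finset.Ico (m * j) (m * j + m)) := by
      intro i j hij
      rw [Finset.disjoint_left]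
      intro x hx hy
      simp only [Finset.mem_Ico] at hx hy
      have : m * (i + 1) ≤ m * j := Nat.mul_le_mul_left m hij
      rw [Nat.mul_succ] at this
      omega
    intro i j hij
    refine indepFun_of_dependsOn ν ((hdep m).comp_shift_iterate (m * i))
      ((hdep m).comp_shift_iterate (m * j)) ?_
    rcases lt_or_gt_of_ne hij with hlt | hlt
    · exact aux i j hlt
    · exact (aux j i hlt).symm
  · refine ⟨((h.measurable m).comp (hT i).measurable).aemeasurable,
      ((h.measurable m).comp (hT 0).measurable).aemeasurable, ?_⟩
    have e : ∀ j, (iidMeasure ν).map (fun w => a m (shift^[m * j] w)) =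
        (iidMeasure ν).map (a m) := by
      intro j
      conv_rhs => rw [← (hT j).map_eq]
      rw [Measure.map_map (h.measurable m) (hT j).measurable]
      rfl
    exact (e i).trans (e 0).symm

end DiscreteIncrements

/-! ### Counting the values of a sequence by first and last occurrences -/

theorem card_image_range_eq_card_first {α : Type*} [DecidableEq α] (x : ℕ → α) (n : ℕ) :
    ((Finset.range n).image x).card =
      ((Finset.range n).filter fun t => ∀ s < t, x s ≠ x t).card := by
  induction n with
  | zero => simp
  | succ n ih =>
    rw [Finset.range_add_one, Finset.image_insert, Finset.filter_insert]
    by_cases h : ∀ s < n, x s ≠ x n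
    · rw [if_pos h, Finset.card_insert_of_notMem (by simpa using h),
        Finset.card_insert_of_notMem (by simp), ih]
    · rw [if_neg h, ← ih, Finset.insert_eq_of_mem]
      push Not at h
      simpa using h

theorem card_image_range_eq_card_last {α : Type*} [DecidableEq α] (x : ℕ → α) (n : ℕ) :
    ((Finset.range n).image x).card =
      ((Finset.range n).filter fun t => ∀ s < n, t < s → x s ≠ x t).card := by
  have himage : ((Finset.range n).filter fun t => ∀ s < n, t < s → x s ≠ x t).image x =
      (Finset.range n).image x := by
    refine (Finset.image_subset_image (Finset.filter_subset _ _)).antisymm fun y hy => ?_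
    obtain ⟨t₀, ht₀, rfl⟩ := Finset.mem_image.1 hy
    obtain ⟨t, ht, hmax⟩ := Finset.exists_max_image
      ((Finset.range n).filter fun t => x t = x t₀) id ⟨t₀, by simpa using ht₀⟩
    simp only [Finset.mem_filter, Finset.mem_range, id, and_imp] at ht hmax
    refine Finset.mem_image.2 ⟨t, ?_, ht.2⟩
    simp only [Finset.mem_filter, Finset.mem_range]
    refine ⟨ht.1, fun s hs hts he => ?_⟩
    have := hmax s hs (he.trans ht.2)
    omega
  rw [← himage, Finset.card_image_of_injOn]
  intro s hs t ht hst
  simp only [Finset.coe_filter, Finset.mem_range, Set.mem_ofPred_eq] at hs ht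
  rcases lt_trichotomy s t with h | h | h
  · exact absurd hst.symm (hs.2 t ht.1 h)
  · exact h
  · exact absurd hst (ht.2 s hs.1 h)

theorem integral_card_filter {Ω : Type*} [MeasurableSpace Ω] (P : Measure Ω)
    [IsProbabilityMeasure P] (p : ℕ → Ω → Prop) [∀ t ω, Decidable (p t ω)]
    (hp : ∀ t, MeasurableSet {ω | p t ω}) (n : ℕ) :
    Integrable (fun ω => (((Finset.range n).filter fun t => p t ω).card : ℝ)) P ∧
    ∫ ω, (((Finset.range n).filter fun t => p t ω).card : ℝ) ∂P =
      ∑ t ∈ Finset.range n, P.real {ω | p t ω} := by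
  have e : ∀ ω, (((Finset.range n).filter fun t => p t ω).card : ℝ) =
      ∑ t ∈ Finset.range n, {ω | p t ω}.indicator (fun _ => (1 : ℝ)) ω := by
    intro ω
    simp [Set.indicator_apply]
  have hi : ∀ t, Integrable ({ω | p t ω}.indicator fun _ => (1 : ℝ)) P :=
    fun t => (integrable_const _).indicator (hp t)
  simp only [e]
  refine ⟨integrable_finsetSum _ fun t _ => hi t, ?_⟩
  rw [integral_finsetSum _ fun t _ => hi t]
  refine Finset.sum_congr rfl fun t _ => ?_
  rw [integral_indicator (hp t)]
  simp

/-! ### The walk as a function of its increments -/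

namespace Lamplighter

variable {G : Type*} [Group G]

/-- The walk with increments `w 0, w 1, …`, as a function on the space of increment sequences. -/
noncomputable def pathWalk (n : ℕ) (w : ℕ → Lamplighter G) : Lamplighter G :=
  walk (fun i w => w i) n w

theorem walk_eq_pathWalk {Ω : Type*} (ξ : ℕ → Ω → Lamplighter G) (n : ℕ) (ω : Ω) :
    walk ξ n ω = pathWalk n fun i => ξ i ω := by
  induction n with
  | zero => rfl
  | succ n ih => rw [walk, ih]; rfl

@[simp]
theorem pathWalk_zero (w : ℕ → Lamplighter G) : pathWalk 0 w = 1 := rfl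

theorem pathWalk_succ (n : ℕ) (w : ℕ → Lamplighter G) :
    pathWalk (n + 1) w = pathWalk n w * w n := rfl

theorem pathWalk_add (m n : ℕ) (w : ℕ → Lamplighter G) :
    pathWalk (m + n) w = pathWalk m w * pathWalk n (shift^[m] w) := by
  induction n with
  | zero => simp
  | succ n ih =>
    rw [← add_assoc, pathWalk_succ, ih, pathWalk_succ, mul_assoc, shift_iterate_apply, add_comm m n]

theorem dependsOn_pathWalk (n : ℕ) :
    DependsOn (pathWalk n : (ℕ → Lamplighter G) → Lamplighter G) (Finset.range n) := by
  induction n with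
  | zero => intro x y _; rfl
  | succ n ih =>
    intro x y hxy
    rw [pathWalk_succ, pathWalk_succ, hxy n (by simp)]
    rw [ih.mono (by simp) hxy]

instance [Countable G] : Countable (Lamplighter G) :=
  Function.Injective.countable (f := fun z : Lamplighter G => (z.lamps, z.pos))
    fun _ _ h => Lamplighter.ext (congrArg Prod.fst h) (congrArg Prod.snd h)

/-- The number of lit lamps of a configuration. -/
noncomputable def lampCount (z : Lamplighter G) : ℕ := z.lamps.support.card

theorem card_support_translate (x : G) (η : G →₀ ZMod 2) :
    (translate x η).support.card = η.support.card := by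
  simp [translate, Finsupp.equivMapDomain]

theorem lampCount_mul_le (a b : Lamplighter G) :
    lampCount (a * b) ≤ lampCount a + lampCount b := by
  classical
  rw [lampCount, mul_lamps]
  refine (Finset.card_le_card Finsupp.support_add).trans ((Finset.card_union_le _ _).trans ?_)
  rw [card_support_translate]
  rfl

theorem support_pathWalk_subset [DecidableEq G] {K : Finset G} {w : ℕ → Lamplighter G}
    (hw : ∀ i, (w i).lamps.support ⊆ K) (n : ℕ) :
    (pathWalk n w).lamps.support ⊆
      Finset.image₂ (· * ·) ((Finset.range n).image fun t => (pathWalk t w).pos) K := by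
  induction n with
  | zero => simp
  | succ n ih =>
    rw [pathWalk_succ, mul_lamps]
    refine Finsupp.support_add.trans (Finset.union_subset (ih.trans ?_) fun y hy => ?_)
    · exact Finset.image₂_subset_right (Finset.image_subset_image (by simp))
    · rw [Finsupp.mem_support_iff, translate_apply] at hy
      exact Finset.mem_image₂.2 ⟨(pathWalk n w).pos, Finset.mem_image_of_mem _ (by simp),
        _, hw n (Finsupp.mem_support_iff.2 hy), mul_inv_cancel_left _ _⟩

/-- The number of lit lamps is at most a constant times the range of the projected walk. -/
theorem lampCount_pathWalk_le [DecidableEq G] {K : Finset G} {w : ℕ → Lamplighter G}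
    (hw : ∀ i, (w i).lamps.support ⊆ K) (n : ℕ) :
    lampCount (pathWalk n w) ≤
      ((Finset.range n).image fun t => (pathWalk t w).pos).card * K.card :=
  (Finset.card_le_card (support_pathWalk_subset hw n)).trans (Finset.card_image₂_le _ _ _)

/-! ### The expected range of the projected walk -/

/-- The probability that the projected walk does not return to the identity up to time `k`. -/
noncomputable def noReturnProb (ν : Measure (Lamplighter G)) [IsProbabilityMeasure ν] (k : ℕ) : ℝ :=
  (iidMeasure ν).real {w | ∀ j, 1 ≤ j → j ≤ k → (pathWalk j w).pos ≠ 1}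

/-- The probability that the projected walk visits its position at time `t` for the first time. -/
noncomputable def firstVisitProb (ν : Measure (Lamplighter G)) [IsProbabilityMeasure ν] (t : ℕ) :
    ℝ :=
  (iidMeasure ν).real {w | ∀ s < t, (pathWalk s w).pos ≠ (pathWalk t w).pos}

theorem dependsOn_noReturn (k : ℕ) :
    DependsOn (fun w : ℕ → Lamplighter G => ∀ j, 1 ≤ j → j ≤ k → (pathWalk j w).pos ≠ 1)
      (Finset.range k) := by
  intro x y hxy
  refine forall_congr fun j => forall_congr fun _ => propext (forall_congr' fun hj => ?_)
  rw [dependsOn_pathWalk j fun i hi => hxy i (by simp at hi ⊢; omega)]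

theorem dependsOn_firstVisit (t : ℕ) :
    DependsOn (fun w : ℕ → Lamplighter G => ∀ s < t, (pathWalk s w).pos ≠ (pathWalk t w).pos)
      (Finset.range t) := by
  intro x y hxy
  refine forall_congr fun s => propext (forall_congr' fun hs => ?_)
  rw [dependsOn_pathWalk t hxy, dependsOn_pathWalk s fun i hi => hxy i (by simp at hi ⊢; omega)]

/-- The walk restarted at time `t` does not return to the identity before time `n` exactly when the
visit at time `t` is the last one before time `n` to that site. -/
theorem lastVisit_iff (n t : ℕ) (ht : t < n) (w : ℕ → Lamplighter G) :
    (∀ s < n, t < s → (pathWalk s w).pos ≠ (pathWalk t w).pos) ↔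
      ∀ j, 1 ≤ j → j ≤ n - 1 - t → (pathWalk j (shift^[t] w)).pos ≠ 1 := by
  have key : ∀ j, (pathWalk (t + j) w).pos = (pathWalk t w).pos ↔
      (pathWalk j (shift^[t] w)).pos = 1 := by
    intro j
    rw [pathWalk_add, mul_pos, mul_eq_left]
  constructor
  · intro h j h1 h2 he
    exact h (t + j) (by omega) (by omega) ((key j).2 he)
  · intro h s hs hts he
    obtain ⟨j, rfl⟩ : ∃ j, s = t + j := ⟨s - t, by omega⟩
    exact h j (by omega) (by omega) ((key j).1 he)

/-- The escape probability of the projected walk. -/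
noncomputable def escapeProb (ν : Measure (Lamplighter G)) [IsProbabilityMeasure ν] : ℝ :=
  (iidMeasure ν).real {w | ∀ j, 1 ≤ j → (pathWalk j w).pos ≠ 1}

theorem escapeProb_le_noReturnProb (ν : Measure (Lamplighter G)) [IsProbabilityMeasure ν]
    (k : ℕ) : escapeProb ν ≤ noReturnProb ν k :=
  measureReal_mono fun _ hw j h1 _ => hw j h1

section Countable

variable [Countable G] (ν : Measure (Lamplighter G)) [IsProbabilityMeasure ν]

theorem measurable_pathWalk (n : ℕ) :
    Measurable (pathWalk n : (ℕ → Lamplighter G) → Lamplighter G) :=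
  (dependsOn_pathWalk n).measurable_of_finset

theorem lastVisit_prob (n t : ℕ) (ht : t < n) :
    (iidMeasure ν).real {w | ∀ s < n, t < s → (pathWalk s w).pos ≠ (pathWalk t w).pos} =
      noReturnProb ν (n - 1 - t) := by
  simp only [lastVisit_iff n t ht]
  exact ((measurePreserving_shift ν).iterate t).measureReal_preimage
    (dependsOn_noReturn (n - 1 - t)).measurableSet_of_finset.nullMeasurableSet

/-- The expected range, counted by last visits. -/
theorem integral_card_range [DecidableEq G] (n : ℕ) :
    Integrable (fun w => (((Finset.range n).image fun t => (pathWalk t w).pos).card : ℝ))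
      (iidMeasure ν) ∧
    ∫ w, (((Finset.range n).image fun t => (pathWalk t w).pos).card : ℝ) ∂iidMeasure ν =
      ∑ k ∈ Finset.range n, noReturnProb ν k := by
  have hmeas : ∀ t, MeasurableSet
      {w : ℕ → Lamplighter G | ∀ s < n, t < s → (pathWalk s w).pos ≠ (pathWalk t w).pos} := by
    intro t
    refine DependsOn.measurableSet_of_finset (s := Finset.range (n + t)) ?_
    intro x y hxy
    refine forall_congr fun s => propext (forall_congr' fun hs => ?_)
    rw [dependsOn_pathWalk t fun i hi => hxy i (by simp at hi ⊢; omega),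
      dependsOn_pathWalk s fun i hi => hxy i (by simp at hi ⊢; omega)]
  simp only [card_image_range_eq_card_last]
  obtain ⟨h1, h2⟩ := integral_card_filter (iidMeasure ν) _ hmeas n
  refine ⟨h1, h2.trans ?_⟩
  rw [← Finset.sum_range_reflect (noReturnProb ν)]
  exact Finset.sum_congr rfl fun t ht => lastVisit_prob ν n t (Finset.mem_range.1 ht)

/-- Counting the range by first visits and by last visits gives the same expectation. -/
theorem sum_firstVisitProb (n : ℕ) :
    ∑ t ∈ Finset.range n, firstVisitProb ν t = ∑ k ∈ Finset.range n, noReturnProb ν k := by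
  classical
  rw [← (integral_card_range ν n).2]
  simp only [card_image_range_eq_card_first]
  exact (integral_card_filter (iidMeasure ν) _
    (fun t => (dependsOn_firstVisit t).measurableSet_of_finset) n).2.symm

theorem tendsto_noReturnProb : Tendsto (noReturnProb ν) atTop (𝓝 (escapeProb ν)) := by
  have e : {w : ℕ → Lamplighter G | ∀ j, 1 ≤ j → (pathWalk j w).pos ≠ 1} =
      ⋂ k, {w | ∀ j, 1 ≤ j → j ≤ k → (pathWalk j w).pos ≠ 1} := by
    ext w
    simp only [Set.mem_ofPred_eq, Set.mem_iInter]
    exact ⟨fun h k j h1 _ => h j h1, fun h j h1 => h j j h1 le_rfl⟩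
  have := tendsto_measure_iInter_atTop (μ := iidMeasure ν)
    (s := fun k => {w : ℕ → Lamplighter G | ∀ j, 1 ≤ j → j ≤ k → (pathWalk j w).pos ≠ 1})
    (fun k => (dependsOn_noReturn k).measurableSet_of_finset.nullMeasurableSet)
    (fun k l hkl w hw j h1 h2 => hw j h1 (h2.trans hkl)) ⟨0, measure_ne_top _ _⟩
  rw [← e] at this
  exact (ENNReal.tendsto_toReal (measure_ne_top _ _)).comp this

end Countable

end Lamplighter

/-! ### Transience makes the number of lit lamps grow linearly -/

namespace Lamplighter

variable {G : Type*} [Group G]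

theorem dependsOn_pathWalk_eq (n : ℕ) (z : Lamplighter G) :
    DependsOn (fun w : ℕ → Lamplighter G => pathWalk n w = z) (Finset.range n) :=
  fun _ _ hxy => congrArg (· = z) (dependsOn_pathWalk n hxy)

theorem pathWalk_shift_eq_prob [Countable G] (ν : Measure (Lamplighter G))
    [IsProbabilityMeasure ν] (t m : ℕ) (z : Lamplighter G) :
    (iidMeasure ν).real {w | pathWalk m (shift^[t] w) = z} =
      (iidMeasure ν).real {w | pathWalk m w = z} :=
  ((measurePreserving_shift ν).iterate t).measureReal_preimage
    (dependsOn_pathWalk_eq m z).measurableSet_of_finset.nullMeasurableSet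

theorem pathWalk_add_eq_mul_prob_pos [Countable G] (ν : Measure (Lamplighter G))
    [IsProbabilityMeasure ν] {z₁ z₂ : Lamplighter G} {m n : ℕ}
    (h₁ : 0 < (iidMeasure ν).real {w | pathWalk m w = z₁})
    (h₂ : 0 < (iidMeasure ν).real {w | pathWalk n w = z₂}) :
    0 < (iidMeasure ν).real {w | pathWalk (m + n) w = z₁ * z₂} := by
  have hdisj : Disjoint (Finset.range m) (Finset.Ico m (m + n)) := by
    rw [Finset.disjoint_left]
    intro x hx hy
    simp only [Finset.mem_range, Finset.mem_Ico] at hx hy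
    omega
  have := iidMeasure_real_and ν (dependsOn_pathWalk_eq m z₁)
    ((dependsOn_pathWalk_eq n z₂).comp_shift_iterate m) hdisj
  rw [pathWalk_shift_eq_prob] at this
  refine (_root_.mul_pos h₁ h₂).trans_le (this.symm.le.trans (measureReal_mono ?_))
  rintro w ⟨e₁, e₂⟩
  rw [Set.mem_ofPred_eq, pathWalk_add, e₁, e₂]

/-- If each element of the group is a product of atoms of `ν`, then the walk hits it with positive
probability at some fixed time. -/
theorem exists_pathWalk_eq_prob_pos [Countable G] (ν : Measure (Lamplighter G))
    [IsProbabilityMeasure ν] (hν : Submonoid.closure {z | 0 < ν.real {z}} = ⊤)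
    (z : Lamplighter G) : ∃ n, 0 < (iidMeasure ν).real {w | pathWalk n w = z} := by
  have hz : z ∈ Submonoid.closure {z | 0 < ν.real {z}} := by rw [hν]; trivial
  induction hz using Submonoid.closure_induction with
  | mem z hz =>
    refine ⟨1, ?_⟩
    have := (measurePreserving_eval_infinitePi (fun _ : ℕ => ν) 0).measureReal_preimage
      (MeasurableSet.of_discrete (s := {z})).nullMeasurableSet
    rw [Set.mem_ofPred_eq, ← this] at hz
    simpa [pathWalk_succ, Set.preimage] using hz
  | one => exact ⟨0, by simp⟩
  | mul z₁ z₂ _ _ h₁ h₂ =>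
    obtain ⟨m, hm⟩ := h₁
    obtain ⟨n, hn⟩ := h₂
    exact ⟨m + n, pathWalk_add_eq_mul_prob_pos ν hm hn⟩

/-- If `z` and `z'` move the lamplighter in the same way and differ at the lamp at the identity,
then in a product `a * z * b`, exchanging `z` with `z'` switches the lamp at the position of `a`. -/
theorem lamp_ne_zero_or {z z' : Lamplighter G} (hpos : z.pos = z'.pos)
    (hlamp : z.lamps 1 ≠ z'.lamps 1) (a b : Lamplighter G) :
    (a * z * b).lamps a.pos ≠ 0 ∨ (a * z' * b).lamps a.pos ≠ 0 := by
  by_contra! h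
  obtain ⟨h1, h2⟩ := h
  have h3 := h1.trans h2.symm
  simp only [mul_lamps, mul_pos, Finsupp.add_apply, translate_apply, inv_mul_cancel, hpos] at h3
  exact hlamp (by simpa using h3)

/-- At a first visit, the visited lamp is finally lit with probability bounded below: the increments
in the window of length `m` after time `t` are independent of all the others, and for each choice of
the others at least one of the values `z`, `z'` of their product leaves that lamp lit. -/
theorem firstVisit_lit_prob_ge [Countable G] (ν : Measure (Lamplighter G))
    [IsProbabilityMeasure ν] {z z' : Lamplighter G} (hpos : z.pos = z'.pos)
    (hlamp : z.lamps 1 ≠ z'.lamps 1) {m : ℕ} {p : ℝ}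
    (hz : p ≤ (iidMeasure ν).real {w | pathWalk m w = z})
    (hz' : p ≤ (iidMeasure ν).real {w | pathWalk m w = z'}) (t q : ℕ) :
    p * firstVisitProb ν t ≤ (iidMeasure ν).real {w |
      (∀ s < t, (pathWalk s w).pos ≠ (pathWalk t w).pos) ∧
        (pathWalk (t + m + q) w).lamps (pathWalk t w).pos ≠ 0} := by
  have hne : z ≠ z' := fun h => hlamp (by rw [h])
  -- `lit y` is the event that the lamp is lit when the window is replaced by `y`.
  let lit : Lamplighter G → (ℕ → Lamplighter G) → Prop := fun y w =>
    (∀ s < t, (pathWalk s w).pos ≠ (pathWalk t w).pos) ∧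
      (pathWalk t w * y * pathWalk q (shift^[t + m] w)).lamps (pathWalk t w).pos ≠ 0
  have hlit : ∀ y, DependsOn (lit y) (Finset.range t ∪ Finset.Ico (t + m) (t + m + q) :
      Finset ℕ) := by
    intro y v w hvw
    have h1 : ∀ i ∈ (Finset.range t : Set ℕ), v i = w i := fun i hi => hvw i (by
      rw [Finset.coe_union]; exact Or.inl hi)
    have h2 : pathWalk q (shift^[t + m] v) = pathWalk q (shift^[t + m] w) :=
      (dependsOn_pathWalk q).comp_shift_iterate (t + m) fun i hi => hvw i (by
        rw [Finset.coe_union]; exact Or.inr hi)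
    have h3 := dependsOn_firstVisit t h1
    simp only [← dependsOn_pathWalk t h1] at h3
    simp only [lit, h2, ← dependsOn_pathWalk t h1, h3]
  have hdisj : Disjoint (Finset.range t ∪ Finset.Ico (t + m) (t + m + q))
      (Finset.Ico t (t + m)) := by
    rw [Finset.disjoint_left]
    intro x hx hy
    simp only [Finset.mem_union, Finset.mem_range, Finset.mem_Ico] at hx hy
    omega
  have hprod : ∀ y, (iidMeasure ν).real {w | lit y w ∧ pathWalk m (shift^[t] w) = y} =
      (iidMeasure ν).real {w | lit y w} * (iidMeasure ν).real {w | pathWalk m w = y} := by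
    intro y
    rw [iidMeasure_real_and ν (hlit y) ((dependsOn_pathWalk_eq m y).comp_shift_iterate t) hdisj,
      pathWalk_shift_eq_prob]
  have hcover : firstVisitProb ν t ≤
      (iidMeasure ν).real {w | lit z w} + (iidMeasure ν).real {w | lit z' w} := by
    refine (measureReal_mono ?_).trans (measureReal_union_le _ _)
    intro w hw
    exact (lamp_ne_zero_or hpos hlamp (pathWalk t w) (pathWalk q (shift^[t + m] w))).imp
      (fun h => ⟨hw, h⟩) fun h => ⟨hw, h⟩
  have hmeas : MeasurableSet {w | lit z' w ∧ pathWalk m (shift^[t] w) = z'} :=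
    (hlit z').measurableSet_of_finset.inter
      ((dependsOn_pathWalk_eq m z').comp_shift_iterate t).measurableSet_of_finset
  have hp0 : ∀ y, 0 ≤ (iidMeasure ν).real {w | lit y w} := fun y => measureReal_nonneg
  rcases le_or_gt p 0 with hp | hp
  · exact (mul_nonpos_of_nonpos_of_nonneg hp measureReal_nonneg).trans measureReal_nonneg
  calc p * firstVisitProb ν t
      ≤ p * ((iidMeasure ν).real {w | lit z w} + (iidMeasure ν).real {w | lit z' w}) := by gcongr
    _ = (iidMeasure ν).real {w | lit z w} * p + (iidMeasure ν).real {w | lit z' w} * p := by ring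
    _ ≤ (iidMeasure ν).real {w | lit z w ∧ pathWalk m (shift^[t] w) = z} +
        (iidMeasure ν).real {w | lit z' w ∧ pathWalk m (shift^[t] w) = z'} := by
      rw [hprod, hprod]
      gcongr
    _ = (iidMeasure ν).real ({w | lit z w ∧ pathWalk m (shift^[t] w) = z} ∪
        {w | lit z' w ∧ pathWalk m (shift^[t] w) = z'}) := by
      rw [measureReal_union _ hmeas]
      rw [Set.disjoint_left]
      rintro w ⟨_, h1⟩ ⟨_, h2⟩
      exact hne (h1.symm.trans h2)
    _ ≤ _ := by
      refine measureReal_mono ?_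
      rintro w (⟨⟨h1, h2⟩, h3⟩ | ⟨⟨h1, h2⟩, h3⟩) <;>
      · refine ⟨h1, ?_⟩
        rw [pathWalk_add, pathWalk_add, h3]
        exact h2

/-- The expected number of lit lamps is at least a constant times the expected range at a time
earlier by a constant. -/
theorem exists_integral_lampCount_ge [Countable G] [Nontrivial G] (ν : Measure (Lamplighter G))
    [IsProbabilityMeasure ν] (hν : Submonoid.closure {z | 0 < ν.real {z}} = ⊤)
    (hint : ∀ n, Integrable (fun w => (lampCount (pathWalk n w) : ℝ)) (iidMeasure ν)) :
    ∃ m : ℕ, ∃ p : ℝ, 0 < p ∧ ∀ n, p * ∑ k ∈ Finset.range n, noReturnProb ν k ≤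
      ∫ w, (lampCount (pathWalk (n + m) w) : ℝ) ∂iidMeasure ν := by
  classical
  -- `a` switches the lamp at the identity and `b` moves to `g`. The products `a * b` and `b * a`
  -- end at the same position, differ at the lamp at the identity, and, having the same factors, are
  -- both reached at the same time with positive probability.
  obtain ⟨g, hg⟩ := exists_ne (1 : G)
  let a : Lamplighter G := ⟨Finsupp.single 1 1, 1⟩
  let b : Lamplighter G := ⟨0, g⟩
  obtain ⟨i, hi⟩ := exists_pathWalk_eq_prob_pos ν hν a
  obtain ⟨j, hj⟩ := exists_pathWalk_eq_prob_pos ν hν b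
  have hab := pathWalk_add_eq_mul_prob_pos ν hi hj
  have hba := pathWalk_add_eq_mul_prob_pos ν hj hi
  rw [add_comm j i] at hba
  have hpos : (a * b).pos = (b * a).pos := by simp [a, b]
  have hlamp : (a * b).lamps 1 ≠ (b * a).lamps 1 := by
    simp [a, b, hg]
  refine ⟨i + j, _, lt_min hab hba, fun n => ?_⟩
  set p := min ((iidMeasure ν).real {w | pathWalk (i + j) w = a * b})
    ((iidMeasure ν).real {w | pathWalk (i + j) w = b * a})
  let E : ℕ → (ℕ → Lamplighter G) → Prop := fun t w =>
    (∀ s < t, (pathWalk s w).pos ≠ (pathWalk t w).pos) ∧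
      (pathWalk (n + (i + j)) w).lamps (pathWalk t w).pos ≠ 0
  have hE : ∀ t, MeasurableSet {w | E t w} := by
    intro t
    refine (dependsOn_firstVisit t).measurableSet_of_finset.inter
      (DependsOn.measurableSet_of_finset (s := Finset.range (t + (n + (i + j)))) ?_)
    intro x y hxy
    have h1 := dependsOn_pathWalk t fun i hi => hxy i (by simp at hi ⊢; omega)
    have h2 := dependsOn_pathWalk (n + (i + j)) fun i hi => hxy i (by simp at hi ⊢; omega)
    simp only [h1, h2]
  obtain ⟨hcard_int, hcard⟩ := integral_card_filter (iidMeasure ν) E hE n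
  calc p * ∑ k ∈ Finset.range n, noReturnProb ν k
      = ∑ t ∈ Finset.range n, p * firstVisitProb ν t := by
        rw [← sum_firstVisitProb, Finset.mul_sum]
    _ ≤ ∑ t ∈ Finset.range n, (iidMeasure ν).real {w | E t w} := by
        refine Finset.sum_le_sum fun t ht => ?_
        have := firstVisit_lit_prob_ge ν hpos hlamp (min_le_left _ _ : p ≤ _) (min_le_right _ _)
          t (n - t)
        have e : t + (i + j) + (n - t) = n + (i + j) := by
          have := Finset.mem_range.1 ht
          omega
        rwa [e] at this
    _ ≤ _ := by
        rw [← hcard]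
        refine integral_mono hcard_int (hint _) fun w => ?_
        simp only [Nat.cast_le]
        refine Finset.card_le_card_of_injOn (fun t => (pathWalk t w).pos) (fun t ht => ?_) ?_
        · simp only [Finset.coe_filter, Set.mem_ofPred_eq] at ht
          exact Finsupp.mem_support_iff.2 ht.2.2
        · intro s hs t ht hst
          simp only [Finset.coe_filter, Set.mem_ofPred_eq] at hs ht
          rcases lt_trichotomy s t with h | h | h
          · exact absurd hst (ht.2.1 s h)
          · exact h
          · exact absurd hst.symm (hs.2.1 t h)

end Lamplighter

/-! ### Finitely generated groups with a weighted word metric -/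

theorem countable_of_closure_finset_eq_top {M : Type*} [Monoid M] {S : Finset M}
    (hS : Submonoid.closure (S : Set M) = ⊤) : Countable M := by
  rw [Submonoid.closure_eq_mrange, MonoidHom.mrange_eq_top] at hS
  exact hS.countable

/-- Balls of the weighted word metric are finite, the edge lengths being bounded away from zero. -/
theorem finite_cayleyDist_le {G : Type*} [Group G] {S : Finset G}
    (hS : Submonoid.closure (S : Set G) = ⊤) {l : G → ℝ} (hl : ∀ s ∈ S, 0 < l s) (R : ℝ) :
    {y | cayleyDist S l 1 y ≤ R}.Finite := by
  obtain ⟨δ, hδ, hlδ⟩ : ∃ δ > 0, ∀ s ∈ S, δ ≤ l s := by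
    rcases S.eq_empty_or_nonempty with rfl | hne
    · exact ⟨1, one_pos, by simp⟩
    · obtain ⟨s, hs, hmin⟩ := S.exists_min_image l hne
      exact ⟨l s, hl s hs, hmin⟩
  refine ((List.finite_length_le S ⌊(R + 1) / δ⌋₊).image
    fun w => (w.map Subtype.val).prod).subset fun y hy => ?_
  obtain ⟨w₀, hw₀, hprod₀⟩ := Submonoid.exists_list_of_mem_closure
    (show y ∈ Submonoid.closure (S : Set G) by rw [hS]; trivial)
  have hlt : cayleyDist S l 1 y < R + 1 := lt_of_le_of_lt hy (lt_add_one R)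
  have hne : {r : ℝ | ∃ w : List G,
      (∀ s ∈ w, s ∈ S) ∧ y = 1 * w.prod ∧ r = (w.map l).sum}.Nonempty :=
    ⟨_, w₀, hw₀, by rw [one_mul, hprod₀], rfl⟩
  obtain ⟨_, ⟨w, hw, hprod, rfl⟩, hsum⟩ := exists_lt_of_csInf_lt hne hlt
  have hlen : w.length * δ ≤ (w.map l).sum := by
    have := List.card_nsmul_le_sum (w.map l) δ (by
      intro x hx
      obtain ⟨s, hs, rfl⟩ := List.mem_map.1 hx
      exact hlδ s (hw s hs))
    simpa using this
  lift w to List S using hw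
  refine ⟨w, ?_, by rw [hprod, one_mul]⟩
  simp only [List.length_map] at hlen
  exact Nat.le_floor ((le_div_iff₀ hδ).2 (hlen.trans hsum.le))

/-! ### The rate of growth of the number of lit lamps -/

theorem ae_mem_support_toMeasure {α : Type*} [MeasurableSpace α] [DiscreteMeasurableSpace α]
    (μ : PMF α) : ∀ᵐ z ∂μ.toMeasure, z ∈ μ.support := by
  rw [ae_iff, PMF.toMeasure_apply_eq_zero_iff _ MeasurableSet.of_discrete, Set.disjoint_left]
  exact fun z hz h => h hz

namespace Lamplighter

variable {G : Type*} [Group G]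

open Classical in
/-- Replaces the elements outside `s` by the identity. Applied to the increments of the walk with
`s` the support of their law, it changes nothing almost surely and makes almost sure bounds on the
increments hold everywhere. -/
noncomputable def truncate (s : Set (Lamplighter G)) (z : Lamplighter G) : Lamplighter G :=
  if z ∈ s then z else 1

theorem truncate_of_mem {s : Set (Lamplighter G)} {z : Lamplighter G} (hz : z ∈ s) :
    truncate s z = z := if_pos hz

theorem support_truncate_subset {s : Set (Lamplighter G)} {K : Finset G}
    (hK : ∀ z ∈ s, z.lamps.support ⊆ K) (z : Lamplighter G) :
    (truncate s z).lamps.support ⊆ K := by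
  unfold truncate
  split_ifs with h
  · exact hK z h
  · simp

theorem isBddSubadditive_lampCount [Countable G] {s : Set (Lamplighter G)} {K : Finset G}
    (hK : ∀ z ∈ s, z.lamps.support ⊆ K) :
    IsBddSubadditive shift
      (fun n w => (lampCount (pathWalk n fun i => truncate s (w i)) : ℝ)) K.card where
  measurable n := by
    have : Measurable fun w : ℕ → Lamplighter G => fun i => truncate s (w i) :=
      measurable_pi_lambda _ fun i =>
        (Measurable.of_discrete (f := truncate s)).comp (measurable_pi_apply i)
    exact (Measurable.of_discrete (f := fun z : Lamplighter G => (lampCount z : ℝ))).comp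
      ((measurable_pathWalk n).comp this)
  nonneg n w := Nat.cast_nonneg _
  le_mul n w := by
    classical
    have h := lampCount_pathWalk_le (fun i => support_truncate_subset hK (w i)) n
    refine (Nat.cast_le.2 (h.trans (Nat.mul_le_mul_right _ Finset.card_image_le))).trans ?_
    simp
  subadd m n w := by
    rw [pathWalk_add, ← Nat.cast_add, Nat.cast_le]
    refine (lampCount_mul_le _ _).trans (le_of_eq ?_)
    congr 3
    funext i
    simp only [shift_iterate_apply]

theorem ae_truncate_eq (μ : PMF (Lamplighter G)) :
    ∀ᵐ w ∂iidMeasure μ.toMeasure, (fun i => truncate μ.support (w i)) = w := by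
  have : ∀ᵐ w ∂iidMeasure μ.toMeasure, ∀ i, w i ∈ μ.support := ae_all_iff.2 fun i =>
    (measurePreserving_eval_infinitePi (fun _ : ℕ => μ.toMeasure) i).quasiMeasurePreserving.ae
      (ae_mem_support_toMeasure μ)
  filter_upwards [this] with w hw
  exact funext fun i => truncate_of_mem (hw i)

/-- The walk on the space of increment sequences: its number of lit lamps has a deterministic linear
rate of growth, which is positive exactly when the projected walk has positive escape
probability. -/
theorem exists_ae_tendsto_lampCount [Countable G] [Nontrivial G] (μ : PMF (Lamplighter G))
    {K : Finset G}
    (hK : ∀ z ∈ μ.support, z.lamps.support ⊆ K) (hμ : Submonoid.closure μ.support = ⊤) :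
    ∃ γ : ℝ, (∀ᵐ w ∂iidMeasure μ.toMeasure,
      Tendsto (fun n : ℕ => (lampCount (pathWalk n w) : ℝ) / n) atTop (𝓝 γ)) ∧
      (0 < γ ↔ 0 < escapeProb μ.toMeasure) := by
  classical
  set ν := μ.toMeasure with hν
  have hsub := isBddSubadditive_lampCount hK
  have hlim := hsub.ae_tendsto_lim_of_dependsOn ν fun n x y hxy => by
    simp only
    rw [dependsOn_pathWalk n fun i hi => by rw [hxy i hi]]
  have hmean := (hsub.subadditive_integral (measurePreserving_shift ν)).tendsto_lim
    hsub.bddBelow_integral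
  set γ := (hsub.subadditive_integral (measurePreserving_shift ν)).lim
  have hae : ∀ n, (fun w => (lampCount (pathWalk n fun i => truncate μ.support (w i)) : ℝ))
      =ᵐ[iidMeasure ν] fun w => (lampCount (pathWalk n w) : ℝ) := by
    intro n
    filter_upwards [ae_truncate_eq μ] with w hw
    rw [hw]
  have hint : ∀ n, Integrable (fun w => (lampCount (pathWalk n w) : ℝ)) (iidMeasure ν) :=
    fun n => (hsub.integrable n).congr (hae n)
  have hmean' : Tendsto (fun n : ℕ => (∫ w, (lampCount (pathWalk n w) : ℝ) ∂iidMeasure ν) / n)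
      atTop (𝓝 γ) := by
    refine hmean.congr fun n => ?_
    rw [integral_congr_ae (hae n)]
  refine ⟨γ, ?_, fun hγ => ?_, fun hesc => ?_⟩
  · filter_upwards [hlim, ae_truncate_eq μ] with w h1 h2
    simpa only [h2] using h1
  · by_contra hesc
    have h0 : escapeProb ν = 0 := le_antisymm (not_lt.1 hesc) measureReal_nonneg
    have hces := (tendsto_noReturnProb ν).cesaro
    rw [h0] at hces
    have hle : ∀ n : ℕ, (∫ w, (lampCount (pathWalk n w) : ℝ) ∂iidMeasure ν) / n ≤
        ((n : ℝ)⁻¹ * ∑ k ∈ Finset.range n, noReturnProb ν k) * K.card := by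
      intro n
      obtain ⟨hi, hr⟩ := integral_card_range ν n
      rw [← hr, div_eq_inv_mul, mul_assoc, ← integral_mul_const]
      refine mul_le_mul_of_nonneg_left (integral_mono_ae (hint n) (hi.mul_const _) ?_)
        (by positivity)
      filter_upwards [ae_truncate_eq μ] with w hw
      have hsupp : ∀ i, (w i).lamps.support ⊆ K := by
        intro i
        rw [← congrFun hw i]
        exact support_truncate_subset hK _
      exact_mod_cast lampCount_pathWalk_le hsupp n
    have := le_of_tendsto_of_tendsto' hmean' (hces.mul_const (K.card : ℝ)) hle
    rw [zero_mul] at this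
    exact absurd hγ (not_lt.2 this)
  · have hgen : Submonoid.closure {z | 0 < ν.real {z}} = ⊤ := by
      convert hμ using 2
      ext z
      rw [Set.mem_ofPred_eq, measureReal_def, hν,
        PMF.toMeasure_apply_singleton _ _ (MeasurableSet.of_discrete),
        ENNReal.toReal_pos_iff, PMF.mem_support_iff]
      exact ⟨fun h => h.1.ne', fun h => ⟨pos_iff_ne_zero.2 h, (μ.apply_ne_top z).lt_top⟩⟩
    obtain ⟨m, p, hp, hlow⟩ := exists_integral_lampCount_ge ν hgen hint
    have hle : ∀ n : ℕ, p * escapeProb ν * ((n : ℝ) / (n + m)) ≤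
        (∫ w, (lampCount (pathWalk (n + m) w) : ℝ) ∂iidMeasure ν) / (n + m : ℕ) := by
      intro n
      rw [← mul_div_assoc, Nat.cast_add]
      gcongr
      refine le_trans ?_ (hlow n)
      rw [mul_assoc]
      gcongr
      have := Finset.card_nsmul_le_sum (Finset.range n) (noReturnProb ν) (escapeProb ν)
        fun k _ => escapeProb_le_noReturnProb ν k
      simpa [mul_comm] using this
    have h1 := (tendsto_natCast_div_add_atTop (𝕜 := ℝ) (m : ℝ)).const_mul (p * escapeProb ν)
    rw [mul_one] at h1
    have := le_of_tendsto_of_tendsto' h1 (hmean'.comp (tendsto_add_atTop_nat m)) hle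
    exact (_root_.mul_pos hp hesc).trans_le this


end Lamplighter

/-! ### The walk driven by random increments -/

theorem theorem3p4 {G : Type*} [Group G] [Infinite G]
    -- a finite symmetric set of generators with edge lengths
    (S : Finset G) (hS_one : (1 : G) ∉ S) (hS_symm : ∀ s ∈ S, s⁻¹ ∈ S)
    (hS_gen : Submonoid.closure (S : Set G) = ⊤)
    (l : G → ℝ) (hl_pos : ∀ s ∈ S, 0 < l s) (hl_symm : ∀ s ∈ S, l s⁻¹ = l s)
    -- the step distribution on the lamplighter group
    (μ : PMF (Lamplighter G))
    -- irreducibility: the support generates the group as a semigroup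
    (hμ_irred : Submonoid.closure μ.support = ⊤)
    -- lamps are switched only in a bounded neighbourhood
    (hμ_range : ∃ R : ℝ, 0 ≤ R ∧
      ∀ z : Lamplighter G, 0 < μ z → ∀ y ∈ z.lamps.support, cayleyDist S l 1 y ≤ R)
    -- the projection to `G` has finite first moment
    (hμ_moment : Summable fun z : Lamplighter G => cayleyDist S l 1 z.pos * (μ z).toReal)
    -- i.i.d. increments with law `μ`
    {Ω : Type*} [MeasurableSpace Ω] (P : Measure Ω) [IsProbabilityMeasure P]
    (ξ : ℕ → Ω → Lamplighter G) (hξ_meas : ∀ n, Measurable (ξ n))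
    (hξ_indep : iIndepFun ξ P) (hξ_law : ∀ n, P.map (ξ n) = μ.toMeasure) :
    ∃ ℓsupp : ℝ,
      (∀ᵐ ω ∂P, Tendsto
        (fun n : ℕ => ((Lamplighter.walk ξ n ω).lamps.support.card : ℝ) / (n : ℝ))
        atTop (𝓝 ℓsupp)) ∧
      (0 < ℓsupp ↔ TransientWalk P (fun n ω => (Lamplighter.walk ξ n ω).pos)) := by
  classical
  have : Countable G := countable_of_closure_finset_eq_top hS_gen
  obtain ⟨R, -, hR⟩ := hμ_range
  have hK : ∀ z ∈ μ.support, z.lamps.support ⊆ (finite_cayleyDist_le hS_gen hl_pos R).toFinset :=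
    fun z hz y hy => by
      simpa using hR z (pos_iff_ne_zero.2 ((PMF.mem_support_iff _ _).1 hz)) y hy
  obtain ⟨γ, hγ, hpos⟩ := Lamplighter.exists_ae_tendsto_lampCount μ hK hμ_irred
  have hpath : Measurable fun ω i => ξ i ω := measurable_pi_lambda _ hξ_meas
  have hlaw : P.map (fun ω i => ξ i ω) = iidMeasure μ.toMeasure := by
    rw [hξ_indep.map_fun_eq_infinitePi_map hξ_meas]
    simp only [hξ_law]
  refine ⟨γ, ?_, hpos.trans ?_⟩
  · rw [← hlaw] at hγ
    filter_upwards [ae_of_ae_map hpath.aemeasurable hγ] with ω hω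
    simpa only [Lamplighter.walk_eq_pathWalk, Lamplighter.lampCount] using hω
  · have hmeas : MeasurableSet
        {w : ℕ → Lamplighter G | ∃ n : ℕ, 1 ≤ n ∧ (Lamplighter.pathWalk n w).pos = 1} := by
      have e : {w : ℕ → Lamplighter G | ∃ n : ℕ, 1 ≤ n ∧ (Lamplighter.pathWalk n w).pos = 1} =
          ⋃ n : ℕ, ⋃ (_ : 1 ≤ n), Lamplighter.pathWalk n ⁻¹' {z | z.pos = 1} := by
        ext w
        simp
      rw [e]
      exact MeasurableSet.iUnion fun n => MeasurableSet.iUnion fun _ =>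
        Lamplighter.measurable_pathWalk n MeasurableSet.of_discrete
    have hP : P {ω | ∃ n : ℕ, 1 ≤ n ∧ (Lamplighter.walk ξ n ω).pos = 1} =
        iidMeasure μ.toMeasure
          {w | ∃ n : ℕ, 1 ≤ n ∧ (Lamplighter.pathWalk n w).pos = 1} := by
      rw [← hlaw, Measure.map_apply hpath hmeas]
      simp only [Lamplighter.walk_eq_pathWalk]
      rfl
    have hesc : Lamplighter.escapeProb μ.toMeasure = 1 - (iidMeasure μ.toMeasure).real
        {w | ∃ n : ℕ, 1 ≤ n ∧ (Lamplighter.pathWalk n w).pos = 1} := by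
      rw [← probReal_compl_eq_one_sub hmeas, Lamplighter.escapeProb]
      congr 1
      ext w
      simp
    rw [TransientWalk, hP, hesc, sub_pos, ← ENNReal.toReal_one, Measure.real,
      ENNReal.toReal_lt_toReal (measure_ne_top _ _) ENNReal.one_ne_top]
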